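/- Let $(X,\mathcal B)$ be a non-empty standard Borel space, $\sigma:X\to X$ a surjective Borel map, and $R$ a transfer operator for $\sigma$ on real Borel functions: a positive linear operator with $R((f\circ\sigma)g)=f\,R(g)$ that is order continuous (if $|f_n|\le h_n$ and $h_n\downarrow 0$ then $|R f_n|\le k_n$ eventually, for some Borel $k_n\downarrow 0$). Its domain is the space of all real Borel functions or, more generally, a linear space of Borel functions that contains the constants and every Borel function dominated in absolute value by one of its members; on a Borel function $f$ outside the domain put $R(f)(x)=\int f\,d\mu_x$, $\mu_x(A)=R(\chi_A)(x)$ (this formula also holds on the domain). Assume that $R$ is normalized, $R(\mathbf 1)=\mathbf 1$. For a measure $\nu$ let $(\nu R)(A)=\int_X R(\chi_A)\,d\nu$ and $(\nu\circ\sigma^{-1})(A)=\nu(\sigma^{-1}(A))$; let $M_1$ be the set of Borel probability measures on $X$ and $K_1=\{\nu R:\nu\in M_1\}$. Let $\mathcal H(X)$ be the universal Hilbert space: its elements are the classes $f\sqrt{d\mu}$ of pairs $(f,\mu)$ with $\mu$ a sigma-finite Borel measure and $f\in L^2(\mu)$ real, where $(f,\mu)\sim(g,\nu)$ iff $f\sqrt{d\mu/d\rho}=g\sqrt{d\nu/d\rho}$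 $\rho$-a.e. for some sigma-finite $\rho$ with $\mu,\nu\ll\rho$; the vector operations are $c\,(f\sqrt{d\mu})=(cf)\sqrt{d\mu}$ and $f\sqrt{d\mu}+g\sqrt{d\nu}=\big(f\sqrt{d\mu/d\rho}+g\sqrt{d\nu/d\rho}\big)\sqrt{d\rho}$, and the inner product is $\langle f\sqrt{d\mu},g\sqrt{d\nu}\rangle=\int fg\sqrt{d\mu/d\rho}\sqrt{d\nu/d\rho}\,d\rho$. Put $\mathcal H(\mu)=\{f\sqrt{d\mu}:f\in L^2(\mu)\}$, and let $\mathcal H_{K_1}$ be the closed linear span of the subspaces $\mathcal H(\mu)$, $\mu\in K_1$. Let $\widehat S(f\sqrt{d\mu})=(f\circ\sigma)\sqrt{d(\mu R)}$ on $\mathcal H(X)$. Every vector of $\mathcal H_{K_1}$ has the form $f\sqrt{d\mu}$ with $\mu\in K_1$, and $\widehat R$ is the operator on $\mathcal H(X)=\mathcal H_{K_1}\oplus\mathcal H_{K_1}^{\perp}$ given by $\widehat R(f\sqrt{d\mu}+u)=R(f)\sqrt{d(\mu\circ\sigma^{-1})}$ for $\mu\in K_1$, $f\in L^2(\mu)$,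 $u\in\mathcal H_{K_1}^{\perp}$; both operators are well defined. Then, for every Borel probability measure $\lambda$ on $X$, the following statements are equivalent: (1) $\lambda\in K_1$; (2) $(\lambda\circ\sigma^{-1})R=\lambda$; (3) for every $f\in L^2(\lambda)$ the function $R(f)\circ\sigma$ is defined $\lambda$-a.e. (that is, $f$ is $\mu_{\sigma(x)}$-integrable for $\lambda$-a.e. $x$) and equals the conditional expectation $\mathbb E_\lambda(f\mid\sigma^{-1}(\mathcal B))$ $\lambda$-a.e.; (4) the operator $\widehat E_1=\widehat S\widehat R$ maps $\mathcal H(\lambda)$ into itself, and $\widehat E_1(f\sqrt{d\lambda})=\mathbb E_\lambda(f\mid\sigma^{-1}(\mathcal B))\sqrt{d\lambda}$ for every $f\in L^2(\lambda)$. -/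

import Mathlib

open MeasureTheory ProbabilityTheory Filter Topology
open scoped ENNReal

/-- A pair `(f, μ)`: a sigma-finite Borel measure `μ` and a real Borel function `f ∈ L²(μ)`. -/
structure SqrtPair (X : Type*) [MeasurableSpace X] where
  measure : Measure X
  fn : X → ℝ
  sigmaFinite : SigmaFinite measure
  measurable_fn : Measurable fn
  memLp : MemLp fn 2 measure

namespace SqrtPair

variable {X : Type*} [MeasurableSpace X]

instance (p : SqrtPair X) : SigmaFinite p.measure := p.sigmaFinite

/-- The function `f √(dμ/dρ)` attached to a pair `(f, μ)` and a measure `ρ`. -/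
noncomputable def density (p : SqrtPair X) (ρ : Measure X) : X → ℝ :=
  fun x => p.fn x * Real.sqrt (p.measure.rnDeriv ρ x).toReal

/-- Equivalence of pairs: `f √(dμ/dρ) = g √(dν/dρ)` holds `ρ`-almost everywhere for some
sigma-finite `ρ` dominating both `μ` and `ν`. -/
def Equivalent (p q : SqrtPair X) : Prop :=
  ∃ ρ : Measure X, SigmaFinite ρ ∧ p.measure ≪ ρ ∧ q.measure ≪ ρ ∧
    p.density ρ =ᵐ[ρ] q.density ρ

lemma measurable_density (p : SqrtPair X) (ρ : Measure X) : Measurable (p.density ρ) :=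
  p.measurable_fn.mul
    (Real.continuous_sqrt.measurable.comp (Measure.measurable_rnDeriv _ _).ennreal_toReal)

lemma density_chain (p : SqrtPair X) {ρ τ : Measure X} [SigmaFinite ρ] [SigmaFinite τ]
    (h : p.measure ≪ ρ) :
    p.density τ =ᵐ[τ] fun x => p.density ρ x * Real.sqrt (ρ.rnDeriv τ x).toReal := by
  filter_upwards [Measure.rnDeriv_mul_rnDeriv (κ := τ) h] with x hx
  simp only [density]
  rw [← hx, Pi.mul_apply, ENNReal.toReal_mul, Real.sqrt_mul ENNReal.toReal_nonneg, mul_assoc]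

lemma ae_of_ae_rnDeriv {ρ τ : Measure X} {P : X → Prop} (h : ∀ᵐ x ∂ρ, P x) :
    ∀ᵐ x ∂τ, ρ.rnDeriv τ x ≠ 0 → P x := by
  rw [← ae_withDensity_iff (Measure.measurable_rnDeriv _ _)]
  exact (Measure.absolutelyContinuous_of_le (Measure.withDensity_rnDeriv_le ρ τ)).ae_le h

lemma density_eq_of_equivalent {p q : SqrtPair X} (h : p.Equivalent q) (τ : Measure X)
    [SigmaFinite τ] : p.density τ =ᵐ[τ] q.density τ := by
  obtain ⟨ρ, hρ, hp, hq, he⟩ := h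
  filter_upwards [p.density_chain (τ := τ) hp, q.density_chain (τ := τ) hq,
    ae_of_ae_rnDeriv (τ := τ) he] with x h1 h2 h3
  rw [h1, h2]
  by_cases h0 : ρ.rnDeriv τ x = 0
  · simp [h0]
  · rw [h3 h0]

lemma equivalent_iff {p q : SqrtPair X} : p.Equivalent q ↔
    ∀ τ : Measure X, SigmaFinite τ → p.density τ =ᵐ[τ] q.density τ := by
  refine ⟨fun h τ _ => density_eq_of_equivalent h τ, fun h => ?_⟩
  have : SigmaFinite (p.measure + q.measure) := inferInstance
  exact ⟨p.measure + q.measure, this, Measure.AbsolutelyContinuous.rfl.add_right _,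
    Measure.AbsolutelyContinuous.rfl.add_right' _, h _ this⟩

lemma density_self (p : SqrtPair X) : p.density p.measure =ᵐ[p.measure] p.fn := by
  filter_upwards [Measure.rnDeriv_self p.measure] with x hx
  simp [density, hx]

/-- If `p.measure = μ` and `q.measure = μ`, equivalence is equality `μ`-almost everywhere. -/
lemma equivalent_of_ae {μ : Measure X} {p q : SqrtPair X} (hp : p.measure = μ)
    (hq : q.measure = μ) (h : p.fn =ᵐ[μ] q.fn) : p.Equivalent q := by
  have : SigmaFinite μ := hp ▸ p.sigmaFinite
  refine ⟨μ, this, hp ▸ .rfl, hq ▸ .rfl, ?_⟩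
  filter_upwards [h] with x hx
  simp [density, hp, hq, hx]

lemma memLp_density (p : SqrtPair X) (ρ : Measure X) [SigmaFinite ρ] :
    MemLp (p.density ρ) 2 ρ := by
  refine (memLp_two_iff_integrable_sq (p.measurable_density ρ).aestronglyMeasurable).2 ?_
  have h1 := (memLp_two_iff_integrable_sq p.measurable_fn.aestronglyMeasurable).1 p.memLp
  have h2 : Integrable (fun x => p.fn x ^ 2) (ρ.withDensity (p.measure.rnDeriv ρ)) :=
    h1.mono_measure (Measure.withDensity_rnDeriv_le _ _)
  rw [integrable_withDensity_iff (Measure.measurable_rnDeriv _ _)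
    (Measure.rnDeriv_lt_top _ _)] at h2
  refine h2.congr (.of_forall fun x => ?_)
  simp only [density]
  rw [mul_pow, Real.sq_sqrt ENNReal.toReal_nonneg]

instance setoid (X : Type*) [MeasurableSpace X] : Setoid (SqrtPair X) where
  r := Equivalent
  iseqv :=
    { refl := fun _ => equivalent_iff.2 fun _ _ => .rfl
      symm := fun h => equivalent_iff.2 fun τ hτ => (equivalent_iff.1 h τ hτ).symm
      trans := fun h k => equivalent_iff.2 fun τ hτ =>
        (equivalent_iff.1 h τ hτ).trans (equivalent_iff.1 k τ hτ) }

/-- `f √dμ + g √dν = (f √(dμ/dρ) + g √(dν/dρ)) √dρ` with `ρ = μ + ν`. -/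
noncomputable def add (p q : SqrtPair X) : SqrtPair X where
  measure := p.measure + q.measure
  fn := fun x => p.density (p.measure + q.measure) x + q.density (p.measure + q.measure) x
  sigmaFinite := inferInstance
  measurable_fn := (p.measurable_density _).add (q.measurable_density _)
  memLp := (p.memLp_density _).add (q.memLp_density _)

/-- `c (f √dμ) = (c f) √dμ`. -/
noncomputable def smul (c : ℝ) (p : SqrtPair X) : SqrtPair X where
  measure := p.measure
  fn := fun x => c * p.fn x
  sigmaFinite := p.sigmaFinite
  measurable_fn := p.measurable_fn.const_mul c
  memLp := p.memLp.const_mul c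

/-- The zero vector. -/
noncomputable def zero : SqrtPair X where
  measure := 0
  fn := fun _ => 0
  sigmaFinite := inferInstance
  measurable_fn := measurable_const
  memLp := MemLp.zero'

lemma density_add (p q : SqrtPair X) (τ : Measure X) [SigmaFinite τ] :
    (add p q).density τ =ᵐ[τ] fun x => p.density τ x + q.density τ x := by
  filter_upwards [p.density_chain (ρ := p.measure + q.measure) (τ := τ)
      (Measure.AbsolutelyContinuous.rfl.add_right _),
    q.density_chain (ρ := p.measure + q.measure) (τ := τ)
      (Measure.AbsolutelyContinuous.rfl.add_right' _)] with x h1 h2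
  rw [h1, h2, ← add_mul]
  rfl

lemma density_smul (c : ℝ) (p : SqrtPair X) (τ : Measure X) (x : X) :
    (smul c p).density τ x = c * p.density τ x := by
  simp [density, smul, mul_assoc]

lemma density_zero (τ : Measure X) (x : X) : (zero : SqrtPair X).density τ x = 0 := by
  simp [density, zero]

/-- `⟨f √dμ, g √dν⟩ = ∫ f g √(dμ/dρ) √(dν/dρ) dρ` with `ρ = μ + ν`. -/
noncomputable def inner (p q : SqrtPair X) : ℝ :=
  ∫ x, p.density (p.measure + q.measure) x * q.density (p.measure + q.measure) x
    ∂(p.measure + q.measure)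

lemma integral_density_mul (p q : SqrtPair X) {ρ τ : Measure X} [SigmaFinite ρ] [SigmaFinite τ]
    (hp : p.measure ≪ ρ) (hq : q.measure ≪ ρ) (h : ρ ≪ τ) :
    ∫ x, p.density τ x * q.density τ x ∂τ = ∫ x, p.density ρ x * q.density ρ x ∂ρ := by
  rw [← integral_rnDeriv_smul h]
  refine integral_congr_ae ?_
  filter_upwards [p.density_chain (τ := τ) hp, q.density_chain (τ := τ) hq] with x h1 h2
  rw [h1, h2, smul_eq_mul, mul_mul_mul_comm, Real.mul_self_sqrt ENNReal.toReal_nonneg, mul_comm]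

/-- The inner product can be computed with any dominating measure. -/
lemma inner_eq (p q : SqrtPair X) {τ : Measure X} [SigmaFinite τ]
    (hp : p.measure ≪ τ) (hq : q.measure ≪ τ) :
    inner p q = ∫ x, p.density τ x * q.density τ x ∂τ := by
  refine (integral_density_mul p q (Measure.AbsolutelyContinuous.rfl.add_right _)
    (Measure.AbsolutelyContinuous.rfl.add_right' _) ?_).symm
  exact Measure.AbsolutelyContinuous.add_left hp hq

end SqrtPair

/-- The universal Hilbert space `ℋ(X)`: equivalence classes `f √dμ` of pairs `(f, μ)`. -/
def UniversalHilbert (X : Type*) [MeasurableSpace X] : Type _ := Quotient (SqrtPair.setoid X)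

namespace UniversalHilbert

variable {X : Type*} [MeasurableSpace X]

/-- The class `f √dμ` of the pair `(f, μ)`. -/
def mk (p : SqrtPair X) : UniversalHilbert X := Quotient.mk _ p

lemma mk_eq_iff {p q : SqrtPair X} : mk p = mk q ↔ p.Equivalent q := Quotient.eq

lemma mk_eq_iff_density {p q : SqrtPair X} : mk p = mk q ↔
    ∀ τ : Measure X, SigmaFinite τ → p.density τ =ᵐ[τ] q.density τ :=
  mk_eq_iff.trans SqrtPair.equivalent_iff

lemma exists_mk (v : UniversalHilbert X) : ∃ p, mk p = v := Quotient.exists_rep v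

noncomputable instance : Add (UniversalHilbert X) :=
  ⟨Quotient.map₂ SqrtPair.add fun p p' hp q q' hq => SqrtPair.equivalent_iff.2 fun τ hτ => by
    filter_upwards [SqrtPair.density_add p q τ, SqrtPair.density_add p' q' τ,
      SqrtPair.equivalent_iff.1 hp τ hτ, SqrtPair.equivalent_iff.1 hq τ hτ] with x h1 h2 h3 h4
    rw [h1, h2, h3, h4]⟩

noncomputable instance : SMul ℝ (UniversalHilbert X) :=
  ⟨fun c => Quotient.map (SqrtPair.smul c) fun p p' hp => SqrtPair.equivalent_iff.2 fun τ hτ => by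
    filter_upwards [SqrtPair.equivalent_iff.1 hp τ hτ] with x h
    rw [SqrtPair.density_smul, SqrtPair.density_smul, h]⟩

noncomputable instance : Zero (UniversalHilbert X) := ⟨mk SqrtPair.zero⟩

noncomputable instance : Neg (UniversalHilbert X) := ⟨fun v => (-1 : ℝ) • v⟩

lemma mk_add (p q : SqrtPair X) : mk p + mk q = mk (p.add q) := rfl

lemma smul_mk (c : ℝ) (p : SqrtPair X) : c • mk p = mk (p.smul c) := rfl

lemma zero_def : (0 : UniversalHilbert X) = mk SqrtPair.zero := rfl

lemma neg_def (v : UniversalHilbert X) : -v = (-1 : ℝ) • v := rfl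

noncomputable instance : AddCommGroup (UniversalHilbert X) :=
  { AddGroup.ofLeftAxioms
      (fun u v w => by
        obtain ⟨p, rfl⟩ := exists_mk u
        obtain ⟨q, rfl⟩ := exists_mk v
        obtain ⟨r, rfl⟩ := exists_mk w
        simp only [mk_add]
        refine mk_eq_iff_density.2 fun τ hτ => ?_
        filter_upwards [SqrtPair.density_add (p.add q) r τ, SqrtPair.density_add p q τ,
          SqrtPair.density_add p (q.add r) τ, SqrtPair.density_add q r τ] with x h1 h2 h3 h4
        rw [h1, h2, h3, h4, add_assoc])
      (fun u => by
        obtain ⟨p, rfl⟩ := exists_mk u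
        rw [zero_def, mk_add]
        refine mk_eq_iff_density.2 fun τ hτ => ?_
        filter_upwards [SqrtPair.density_add SqrtPair.zero p τ] with x h1
        rw [h1, SqrtPair.density_zero, zero_add])
      (fun u => by
        obtain ⟨p, rfl⟩ := exists_mk u
        rw [zero_def, neg_def, smul_mk, mk_add]
        refine mk_eq_iff_density.2 fun τ hτ => ?_
        filter_upwards [SqrtPair.density_add (p.smul (-1)) p τ] with x h1
        rw [h1, SqrtPair.density_zero, SqrtPair.density_smul]
        ring) with
    add_comm := fun u v => by
      obtain ⟨p, rfl⟩ := exists_mk u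
      obtain ⟨q, rfl⟩ := exists_mk v
      simp only [mk_add]
      refine mk_eq_iff_density.2 fun τ hτ => ?_
      filter_upwards [SqrtPair.density_add p q τ, SqrtPair.density_add q p τ] with x h1 h2
      rw [h1, h2, add_comm] }

noncomputable instance : Module ℝ (UniversalHilbert X) where
  one_smul u := by
    obtain ⟨p, rfl⟩ := exists_mk u
    rw [smul_mk]
    refine mk_eq_iff_density.2 fun τ hτ => .of_forall fun x => ?_
    rw [SqrtPair.density_smul, one_mul]
  mul_smul a b u := by
    obtain ⟨p, rfl⟩ := exists_mk u
    simp only [smul_mk]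
    refine mk_eq_iff_density.2 fun τ hτ => .of_forall fun x => ?_
    simp only [SqrtPair.density_smul, mul_assoc]
  smul_zero a := by
    rw [zero_def, smul_mk]
    refine mk_eq_iff_density.2 fun τ hτ => .of_forall fun x => ?_
    simp only [SqrtPair.density_smul, SqrtPair.density_zero, mul_zero]
  zero_smul u := by
    obtain ⟨p, rfl⟩ := exists_mk u
    rw [zero_def, smul_mk]
    refine mk_eq_iff_density.2 fun τ hτ => .of_forall fun x => ?_
    simp only [SqrtPair.density_smul, SqrtPair.density_zero, zero_mul]
  smul_add a u v := by
    obtain ⟨p, rfl⟩ := exists_mk u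
    obtain ⟨q, rfl⟩ := exists_mk v
    simp only [smul_mk, mk_add]
    refine mk_eq_iff_density.2 fun τ hτ => ?_
    filter_upwards [SqrtPair.density_add p q τ,
      SqrtPair.density_add (p.smul a) (q.smul a) τ] with x h1 h2
    rw [h2, SqrtPair.density_smul, SqrtPair.density_smul, SqrtPair.density_smul, h1, mul_add]
  add_smul a b u := by
    obtain ⟨p, rfl⟩ := exists_mk u
    simp only [smul_mk, mk_add]
    refine mk_eq_iff_density.2 fun τ hτ => ?_
    filter_upwards [SqrtPair.density_add (p.smul a) (p.smul b) τ] with x h2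
    rw [h2, SqrtPair.density_smul, SqrtPair.density_smul, SqrtPair.density_smul, add_mul]

lemma inner_wellDefined (p q p' q' : SqrtPair X) (hp : p.Equivalent p') (hq : q.Equivalent q') :
    p.inner q = p'.inner q' := by
  set τ := p.measure + q.measure + (p'.measure + q'.measure) with hτ
  have h1 : p.measure + q.measure ≪ τ := Measure.AbsolutelyContinuous.rfl.add_right _
  have h2 : p'.measure + q'.measure ≪ τ := Measure.AbsolutelyContinuous.rfl.add_right' _
  rw [p.inner_eq q ((Measure.AbsolutelyContinuous.rfl.add_right _).trans h1)
      ((Measure.AbsolutelyContinuous.rfl.add_right' _).trans h1),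
    p'.inner_eq q' ((Measure.AbsolutelyContinuous.rfl.add_right _).trans h2)
      ((Measure.AbsolutelyContinuous.rfl.add_right' _).trans h2)]
  refine integral_congr_ae ?_
  filter_upwards [SqrtPair.density_eq_of_equivalent hp τ,
    SqrtPair.density_eq_of_equivalent hq τ] with x h3 h4
  rw [h3, h4]

/-- The inner product of `ℋ(X)`. -/
noncomputable def innerFun : UniversalHilbert X → UniversalHilbert X → ℝ :=
  Quotient.lift₂ SqrtPair.inner inner_wellDefined

lemma innerFun_mk (p q : SqrtPair X) : innerFun (mk p) (mk q) = p.inner q := rfl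

@[reducible] noncomputable def core : InnerProductSpace.Core ℝ (UniversalHilbert X) where
  inner := innerFun
  conj_inner_symm u v := by
    obtain ⟨p, rfl⟩ := exists_mk u
    obtain ⟨q, rfl⟩ := exists_mk v
    rw [innerFun_mk, innerFun_mk, p.inner_eq q (τ := q.measure + p.measure)
      (Measure.AbsolutelyContinuous.rfl.add_right' _)
      (Measure.AbsolutelyContinuous.rfl.add_right _)]
    simp only [SqrtPair.inner, conj_trivial, mul_comm]
  re_inner_nonneg u := by
    obtain ⟨p, rfl⟩ := exists_mk u
    exact integral_nonneg fun x => mul_self_nonneg _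
  add_left u v w := by
    obtain ⟨p, rfl⟩ := exists_mk u
    obtain ⟨q, rfl⟩ := exists_mk v
    obtain ⟨r, rfl⟩ := exists_mk w
    set τ := p.measure + q.measure + r.measure with hτ
    have h : p.measure + q.measure ≪ τ := Measure.AbsolutelyContinuous.rfl.add_right _
    have hp : p.measure ≪ τ := (Measure.AbsolutelyContinuous.rfl.add_right _).trans h
    have hq : q.measure ≪ τ := (Measure.AbsolutelyContinuous.rfl.add_right' _).trans h
    have hr : r.measure ≪ τ := Measure.AbsolutelyContinuous.rfl.add_right' _
    rw [mk_add, innerFun_mk, innerFun_mk, innerFun_mk, (p.add q).inner_eq r h hr, p.inner_eq r hp hr,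
      q.inner_eq r hq hr, ← integral_add]
    · refine integral_congr_ae ?_
      filter_upwards [SqrtPair.density_add p q τ] with x hx
      rw [hx, add_mul]
    · exact (p.memLp_density τ).integrable_mul (r.memLp_density τ)
    · exact (q.memLp_density τ).integrable_mul (r.memLp_density τ)
  smul_left u v c := by
    obtain ⟨p, rfl⟩ := exists_mk u
    obtain ⟨q, rfl⟩ := exists_mk v
    rw [smul_mk, innerFun_mk, innerFun_mk]
    simp only [SqrtPair.inner, SqrtPair.density_smul, conj_trivial, mul_assoc]
    rw [integral_const_mul]
    rfl
  definite u h := by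
    obtain ⟨p, rfl⟩ := exists_mk u
    rw [innerFun_mk, p.inner_eq p (τ := p.measure) .rfl .rfl, integral_eq_zero_iff_of_nonneg
      (fun x => mul_self_nonneg _)
      ((p.memLp_density _).integrable_mul (p.memLp_density _))] at h
    rw [zero_def, mk_eq_iff]
    refine ⟨p.measure, p.sigmaFinite, .rfl, Measure.AbsolutelyContinuous.zero _, ?_⟩
    filter_upwards [h] with x hx
    rw [SqrtPair.density_zero]
    simpa using hx

noncomputable instance : NormedAddCommGroup (UniversalHilbert X) := core.toNormedAddCommGroup

noncomputable instance : InnerProductSpace ℝ (UniversalHilbert X) :=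
  InnerProductSpace.ofCore core.toCore

lemma inner_mk (p q : SqrtPair X) : inner ℝ (mk p) (mk q) = p.inner q := rfl

/-- The vector `f √dμ`. -/
def vec (μ : Measure X) [SigmaFinite μ] (f : X → ℝ) (hf : Measurable f) (h2 : MemLp f 2 μ) :
    UniversalHilbert X :=
  mk ⟨μ, f, inferInstance, hf, h2⟩

lemma vec_congr {μ : Measure X} [SigmaFinite μ] {f g : X → ℝ} {hf : Measurable f}
    {hf2 : MemLp f 2 μ} {hg : Measurable g} {hg2 : MemLp g 2 μ} (h : f =ᵐ[μ] g) :
    vec μ f hf hf2 = vec μ g hg hg2 :=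
  mk_eq_iff.2 (SqrtPair.equivalent_of_ae rfl rfl h)

lemma exists_vec (v : UniversalHilbert X) : ∃ (μ : Measure X) (_ : SigmaFinite μ) (f : X → ℝ)
    (hf : Measurable f) (h2 : MemLp f 2 μ), v = vec μ f hf h2 := by
  obtain ⟨p, rfl⟩ := exists_mk v
  exact ⟨p.measure, p.sigmaFinite, p.fn, p.measurable_fn, p.memLp, rfl⟩

lemma vec_add {μ : Measure X} [SigmaFinite μ] {f g : X → ℝ} (hf : Measurable f)
    (hf2 : MemLp f 2 μ) (hg : Measurable g) (hg2 : MemLp g 2 μ) :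
    vec μ f hf hf2 + vec μ g hg hg2 = vec μ (f + g) (hf.add hg) (hf2.add hg2) := by
  unfold vec
  rw [mk_add, mk_eq_iff_density]
  intro τ hτ
  filter_upwards [SqrtPair.density_add ⟨μ, f, inferInstance, hf, hf2⟩
    ⟨μ, g, inferInstance, hg, hg2⟩ τ] with x hx
  rw [hx]
  simp [SqrtPair.density, add_mul]

lemma inner_vec {μ : Measure X} [SigmaFinite μ] {f g : X → ℝ} (hf : Measurable f)
    (hf2 : MemLp f 2 μ) (hg : Measurable g) (hg2 : MemLp g 2 μ) :
    inner ℝ (vec μ f hf hf2) (vec μ g hg hg2) = ∫ x, f x * g x ∂μ := by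
  unfold vec
  rw [inner_mk, SqrtPair.inner_eq (τ := μ) _ _ .rfl .rfl]
  refine integral_congr_ae ?_
  filter_upwards [SqrtPair.density_self ⟨μ, f, inferInstance, hf, hf2⟩,
    SqrtPair.density_self ⟨μ, g, inferInstance, hg, hg2⟩] with x h1 h2
  rw [h1, h2]

/-- The isometric embedding `ι : f ↦ f √dμ` of `L²(μ)` into `ℋ(X)`. -/
noncomputable def iota (μ : Measure X) [SigmaFinite μ] : Lp ℝ 2 μ →ₗᵢ[ℝ] UniversalHilbert X where
  toFun f := vec μ f (Lp.stronglyMeasurable f).measurable (Lp.memLp f)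
  map_add' f g := by
    rw [vec_add]
    exact vec_congr (Lp.coeFn_add f g)
  map_smul' c f := by
    simp only [RingHom.id_apply]
    unfold vec
    rw [smul_mk, mk_eq_iff]
    exact SqrtPair.equivalent_of_ae rfl rfl (Lp.coeFn_smul c f)
  norm_map' f := by
    rw [← sq_eq_sq₀ (norm_nonneg _) (norm_nonneg _), ← real_inner_self_eq_norm_sq,
      ← real_inner_self_eq_norm_sq]
    change inner ℝ (vec μ f _ _) (vec μ f _ _) = _
    rw [inner_vec, L2.inner_def]
    rfl

/-- The subspace `ℋ(μ) = {f √dμ : f ∈ L²(μ)}` of `ℋ(X)`. -/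
noncomputable def subspace (μ : Measure X) [SigmaFinite μ] : Submodule ℝ (UniversalHilbert X) :=
  LinearMap.range (iota μ).toLinearMap

lemma vec_mem_subspace (μ : Measure X) [SigmaFinite μ] {f : X → ℝ} (hf : Measurable f)
    (h2 : MemLp f 2 μ) : vec μ f hf h2 ∈ subspace μ :=
  ⟨h2.toLp f, vec_congr h2.coeFn_toLp⟩

lemma mem_subspace_iff {μ : Measure X} [SigmaFinite μ] {v : UniversalHilbert X} :
    v ∈ subspace μ ↔ ∃ (f : X → ℝ) (hf : Measurable f) (h2 : MemLp f 2 μ), v = vec μ f hf h2 := by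
  constructor
  · rintro ⟨f, rfl⟩
    exact ⟨f, _, _, rfl⟩
  · rintro ⟨f, hf, h2, rfl⟩
    exact vec_mem_subspace μ hf h2

lemma subspace_mono {μ ν : Measure X} [SigmaFinite μ] [SigmaFinite ν] (h : μ ≪ ν) :
    subspace μ ≤ subspace ν := by
  intro v hv
  obtain ⟨f, hf, h2, rfl⟩ := mem_subspace_iff.1 hv
  let p : SqrtPair X := ⟨μ, f, inferInstance, hf, h2⟩
  refine mem_subspace_iff.2 ⟨p.density ν, p.measurable_density ν, p.memLp_density ν, ?_⟩
  refine mk_eq_iff.2 ⟨ν, inferInstance, h, .rfl, ?_⟩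
  filter_upwards [SqrtPair.density_self
    ⟨ν, p.density ν, inferInstance, p.measurable_density ν, p.memLp_density ν⟩] with x hx
  exact hx.symm

lemma isComplete_subspace (μ : Measure X) [SigmaFinite μ] :
    IsComplete (subspace μ : Set (UniversalHilbert X)) := by
  have := (iota μ).isometry.isUniformInducing.isComplete_range
  exact this

instance : CompleteSpace (UniversalHilbert X) := by
  refine Metric.complete_of_cauchySeq_tendsto fun u hu => ?_
  choose μ hμ f hf h2 hv using fun n => exists_vec (u n)
  have hle : ∀ n, μ n ≪ (Measure.sum μ).toFinite := fun n =>
    (Measure.le_sum μ n).absolutelyContinuous.trans (absolutelyContinuous_toFinite _)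
  have hm : ∀ n, u n ∈ (subspace (Measure.sum μ).toFinite : Set (UniversalHilbert X)) := fun n =>
    subspace_mono (hle n) (by rw [hv n]; exact vec_mem_subspace _ _ _)
  obtain ⟨v, -, hv⟩ := cauchySeq_tendsto_of_isComplete (isComplete_subspace _) hm hu
  exact ⟨v, hv⟩

end UniversalHilbert

/-- Order convergence to `0` of a sequence of functions, with dominating functions in `D`:
`|f n| ≤ h n` eventually, for some sequence `h n ∈ D` with `h n ↓ 0`. -/
def OrderTendstoZero {X : Type*} (D : Set (X → ℝ)) (f : ℕ → X → ℝ) : Prop :=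
  ∃ h : ℕ → X → ℝ, (∀ n, h n ∈ D) ∧ Antitone h ∧ (∀ x, Tendsto (fun n => h n x) atTop (𝓝 0)) ∧
    ∃ N, ∀ n, N ≤ n → ∀ x, |f n x| ≤ h n x

/-- A transfer operator `(R, σ)` on Borel functions: `σ` is a surjective Borel endomorphism of
`X`, and `R = op` is a positive, order continuous linear operator satisfying the pull-out property
`R((f ∘ σ) g) = f R(g)`. The operator acts on a space `domain` of real Borel functions that contains
the constants and is closed under domination. The space of all Borel functions is a possible
domain; smaller domains accommodate operators such as `f ↦ ∫ f dμ_x`, where `μ_x` is a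
system of conditional measures, that do not make sense for every unbounded Borel function. -/
structure TransferOperator (X : Type*) [MeasurableSpace X] where
  σ : X → X
  measurable_σ : Measurable σ
  surjective_σ : Function.Surjective σ
  domain : Submodule ℝ (X → ℝ)
  measurable_of_mem : ∀ f ∈ domain, Measurable f
  one_mem : (fun _ => 1) ∈ domain
  solid : ∀ f g : X → ℝ, Measurable f → g ∈ domain → (∀ x, |f x| ≤ |g x|) → f ∈ domain
  op : domain →ₗ[ℝ] (X → ℝ)
  measurable_op : ∀ g : domain, Measurable (op g)
  op_nonneg : ∀ g : domain, (∀ x, 0 ≤ g.1 x) → ∀ x, 0 ≤ op g x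
  pull_out : ∀ (f : X → ℝ) (g : domain), Measurable f →
    ∀ h : (fun x => f (σ x) * g.1 x) ∈ domain, ∀ x, op ⟨_, h⟩ x = f x * op g x
  order_continuous : ∀ f : ℕ → domain, OrderTendstoZero (domain : Set (X → ℝ)) (fun n => (f n).1) →
    OrderTendstoZero {g : X → ℝ | Measurable g} (fun n => op (f n))

namespace TransferOperator

variable {X : Type*} [MeasurableSpace X] (R : TransferOperator X)

/-- `R` is normalized if `R(𝟏) = 𝟏`. -/
def Normalized : Prop := ∀ x, R.op ⟨fun _ => 1, R.one_mem⟩ x = 1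

lemma indicator_mem {A : Set X} (hA : MeasurableSet A) :
    A.indicator (fun _ => (1 : ℝ)) ∈ R.domain := by
  refine R.solid _ _ (measurable_const.indicator hA) R.one_mem fun x => ?_
  by_cases h : x ∈ A <;> simp [h]

lemma op_congr {f g : X → ℝ} (h : f = g) (hf : f ∈ R.domain) (hg : g ∈ R.domain) :
    R.op ⟨f, hf⟩ = R.op ⟨g, hg⟩ := by subst h; rfl

/-- `R(χ_A)`. -/
noncomputable def opInd (A : Set X) (hA : MeasurableSet A) : X → ℝ :=
  R.op ⟨_, R.indicator_mem hA⟩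

lemma opInd_nonneg {A : Set X} (hA : MeasurableSet A) (x : X) : 0 ≤ R.opInd A hA x :=
  R.op_nonneg _ (fun _ => Set.indicator_nonneg (fun _ _ => zero_le_one) _) x

lemma tendsto_op {f : ℕ → R.domain} (hanti : Antitone fun n => (f n).1)
    (h0 : ∀ x, Tendsto (fun n => (f n).1 x) atTop (𝓝 0)) (x : X) :
    Tendsto (fun n => R.op (f n) x) atTop (𝓝 0) := by
  have hnn : ∀ n y, 0 ≤ (f n).1 y := fun n y =>
    Antitone.le_of_tendsto (fun a b hab => hanti hab y) (h0 y) n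
  obtain ⟨h, -, -, ht, N, hN⟩ := R.order_continuous f
    ⟨fun n => (f n).1, fun n => (f n).2, hanti, h0, 0, fun n _ y => (abs_of_nonneg (hnn n y)).le⟩
  refine squeeze_zero_norm' ?_ (ht x)
  filter_upwards [eventually_ge_atTop N] with n hn using hN n hn x

lemma opInd_union {A B : Set X} (hA : MeasurableSet A) (hB : MeasurableSet B)
    (hAB : Disjoint A B) (x : X) :
    R.opInd (A ∪ B) (hA.union hB) x = R.opInd A hA x + R.opInd B hB x := by
  unfold opInd
  rw [← Pi.add_apply, ← map_add]
  exact congrFun (R.op_congr (Set.indicator_union_of_disjoint hAB _) _ _) x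

lemma opInd_congr {A B : Set X} (h : A = B) (hA : MeasurableSet A) (hB : MeasurableSet B) :
    R.opInd A hA = R.opInd B hB := by subst h; rfl

lemma opInd_empty (x : X) : R.opInd ∅ .empty x = 0 := by
  have := R.opInd_union .empty .empty (Set.disjoint_empty ∅) x
  rw [R.opInd_congr (Set.empty_union ∅) _ .empty] at this
  linarith

lemma opInd_iUnion ⦃A : ℕ → Set X⦄ (hA : ∀ i, MeasurableSet (A i))
    (hd : Pairwise (Function.onFun Disjoint A)) (x : X) :
    HasSum (fun i => R.opInd (A i) (hA i) x) (R.opInd (⋃ i, A i) (.iUnion hA) x) := by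
  have hT : ∀ n, MeasurableSet (⋃ i, A (i + n)) := fun n => .iUnion fun i => hA _
  have hsplit : ∀ n, (⋃ i, A (i + n)) = A n ∪ ⋃ i, A (i + (n + 1)) := by
    intro n
    ext y
    simp only [Set.mem_iUnion, Set.mem_union]
    constructor
    · rintro ⟨i, hi⟩
      rcases i with _ | i
      · left; simpa using hi
      · right; exact ⟨i, by convert hi using 2; ring⟩
    · rintro (h | ⟨i, hi⟩)
      · exact ⟨0, by simpa using h⟩
      · exact ⟨i + 1, by convert hi using 2; ring⟩
  have hdisj : ∀ n, Disjoint (A n) (⋃ i, A (i + (n + 1))) := fun n =>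
    Set.disjoint_iUnion_right.2 fun i => hd (by omega)
  have hsum : ∀ n, R.opInd (⋃ i, A i) (.iUnion hA) x =
      ∑ i ∈ Finset.range n, R.opInd (A i) (hA i) x + R.opInd (⋃ i, A (i + n)) (hT n) x := by
    intro n
    induction n with
    | zero => simp
    | succ n ih =>
      rw [ih, Finset.sum_range_succ, add_assoc, ← R.opInd_union _ _ (hdisj n)]
      rw [R.opInd_congr (hsplit n)]
  have hanti : Antitone fun n => (⋃ i, A (i + n)) := antitone_nat_of_succ_le fun n => by
    rw [hsplit n]; exact Set.subset_union_right
  have hlim : Tendsto (fun n => R.opInd (⋃ i, A (i + n)) (hT n) x) atTop (𝓝 0) := by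
    refine R.tendsto_op (f := fun n => ⟨_, R.indicator_mem (hT n)⟩) ?_ ?_ x
    · intro m n hmn y
      exact Set.indicator_le_indicator_of_subset (hanti hmn) (fun _ => zero_le_one) y
    · intro y
      refine tendsto_const_nhds.congr' ?_
      by_cases hy : ∃ j, y ∈ A j
      · obtain ⟨j, hj⟩ := hy
        filter_upwards [eventually_gt_atTop j] with n hn
        rw [Set.indicator_of_notMem]
        simp only [Set.mem_iUnion, not_exists]
        exact fun i hi => Set.disjoint_left.1 (hd (show j ≠ i + n by omega)) hj hi
      · push Not at hy
        refine .of_forall fun n => ?_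
        dsimp only
        rw [Set.indicator_of_notMem]
        simp [hy]
  rw [hasSum_iff_tendsto_nat_of_nonneg fun i => R.opInd_nonneg (hA i) x]
  have : (fun n => ∑ i ∈ Finset.range n, R.opInd (A i) (hA i) x) = fun n =>
      R.opInd (⋃ i, A i) (.iUnion hA) x - R.opInd (⋃ i, A (i + n)) (hT n) x := by
    funext n
    rw [hsum n]; ring
  rw [this]
  simpa using hlim.const_sub (R.opInd (⋃ i, A i) (.iUnion hA) x)

/-- The measure `A ↦ R(χ_A)(x)`. -/
noncomputable def fiber (x : X) : Measure X :=
  Measure.ofMeasurable (fun A hA => ENNReal.ofReal (R.opInd A hA x))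
    (by simp [R.opInd_empty]) (fun A hA hd => by
      have h := R.opInd_iUnion hA hd x
      rw [← h.tsum_eq, ENNReal.ofReal_tsum_of_nonneg (fun i => R.opInd_nonneg (hA i) x)
        h.summable])

lemma fiber_apply (x : X) {A : Set X} (hA : MeasurableSet A) :
    R.fiber x A = ENNReal.ofReal (R.opInd A hA x) := Measure.ofMeasurable_apply _ hA

/-- The family of measures `A ↦ R(χ_A)(x)`, measurable in `x`. -/
noncomputable def kernel : Kernel X X where
  toFun := R.fiber
  measurable' := Measure.measurable_of_measurable_coe _ fun A hA => by
    simp only [R.fiber_apply _ hA]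
    exact (R.measurable_op _).ennreal_ofReal

lemma kernel_apply (x : X) {A : Set X} (hA : MeasurableSet A) :
    R.kernel x A = ENNReal.ofReal (R.opInd A hA x) := R.fiber_apply x hA

/-- The action `μ ↦ μR` on measures: `(μR)(A) = ∫ R(χ_A) dμ`, see `act_apply`. -/
noncomputable def act (μ : Measure X) : Measure X := μ.bind R.kernel

lemma act_apply (μ : Measure X) {A : Set X} (hA : MeasurableSet A) :
    R.act μ A = ∫⁻ x, ENNReal.ofReal (R.op ⟨_, R.indicator_mem hA⟩ x) ∂μ := by
  rw [act, Measure.bind_apply hA R.kernel.aemeasurable]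
  simp only [R.kernel_apply _ hA]
  rfl

instance (x : X) : IsFiniteMeasure (R.kernel x) :=
  ⟨by rw [R.kernel_apply x .univ]; exact ENNReal.ofReal_lt_top⟩

/-- The set `K₁ = M₁(X) R` of the measures `νR`, where `ν` is a Borel probability measure. -/
def K₁ : Set (Measure X) := {μ | ∃ ν : Measure X, IsProbabilityMeasure ν ∧ μ = R.act ν}

open Classical in
/-- The function `R(f)`. For Borel functions outside the domain of `R`, the operator is extended by
`R(f)(x) = ∫ f dμ_x` with `μ_x(A) = R(χ_A)(x)`; this formula is also valid on the
domain, see `apply_eq_integral`. -/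
noncomputable def apply (f : X → ℝ) (x : X) : ℝ :=
  if h : f ∈ R.domain then R.op ⟨f, h⟩ x else ∫ y, f y ∂(R.kernel x)

lemma op_simple (s : SimpleFunc X ℝ) (hs : (s : X → ℝ) ∈ R.domain) (x : X) :
    R.op ⟨s, hs⟩ x = ∫ y, s y ∂(R.kernel x) := by
  have key : ∀ s : SimpleFunc X ℝ, ∃ h : (s : X → ℝ) ∈ R.domain,
      R.op ⟨s, h⟩ x = ∫ y, s y ∂(R.kernel x) := by
    intro s
    induction s using SimpleFunc.induction with
    | const c hA =>
      rename_i A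
      have he : ((SimpleFunc.piecewise A hA (SimpleFunc.const X c) (SimpleFunc.const X 0) :
          SimpleFunc X ℝ) : X → ℝ) = c • A.indicator (fun _ => (1 : ℝ)) := by
        ext y
        by_cases hy : y ∈ A <;> simp [hy]
      refine ⟨he ▸ R.domain.smul_mem c (R.indicator_mem hA), ?_⟩
      have h2 : R.op ⟨_, he ▸ R.domain.smul_mem c (R.indicator_mem hA)⟩ =
          c • R.op ⟨_, R.indicator_mem hA⟩ := by
        rw [← map_smul]
        congr 1
        exact Subtype.ext he
      rw [h2, he]
      simp only [Pi.smul_apply, smul_eq_mul]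
      rw [integral_const_mul, integral_indicator_const _ hA, Measure.real, R.kernel_apply x hA,
        ENNReal.toReal_ofReal (R.opInd_nonneg hA x)]
      simp [opInd]
    | add hd hf hg =>
      rename_i f g
      obtain ⟨h1, e1⟩ := hf
      obtain ⟨h2, e2⟩ := hg
      refine ⟨R.domain.add_mem h1 h2, ?_⟩
      have h3 : R.op ⟨(f + g : SimpleFunc X ℝ), R.domain.add_mem h1 h2⟩ =
          R.op ⟨f, h1⟩ + R.op ⟨g, h2⟩ := by
        rw [← map_add]
        rfl
      rw [h3, Pi.add_apply, e1, e2, ← integral_add (SimpleFunc.integrable_of_isFiniteMeasure f)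
        (SimpleFunc.integrable_of_isFiniteMeasure g)]
      rfl
  exact (key s).2

lemma op_eq_integral_of_nonneg (f : R.domain) (hf : ∀ y, 0 ≤ f.1 y) (x : X) :
    Integrable f.1 (R.kernel x) ∧ R.op f x = ∫ y, f.1 y ∂(R.kernel x) := by
  have hm := R.measurable_of_mem _ f.2
  let s : ℕ → SimpleFunc X ℝ := fun n =>
    (SimpleFunc.eapprox (fun y => ENNReal.ofReal (f.1 y)) n).map ENNReal.toReal
  have hle : ∀ n y, SimpleFunc.eapprox (fun y => ENNReal.ofReal (f.1 y)) n y ≤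
      ENNReal.ofReal (f.1 y) := fun n y => by
    rw [← SimpleFunc.iSup_eapprox_apply hm.ennreal_ofReal y]
    exact le_iSup (fun n => SimpleFunc.eapprox (fun y => ENNReal.ofReal (f.1 y)) n y) n
  have hs0 : ∀ n y, 0 ≤ s n y := fun n y => ENNReal.toReal_nonneg
  have hsf : ∀ n y, s n y ≤ f.1 y := fun n y => by
    have := ENNReal.toReal_mono ENNReal.ofReal_ne_top (hle n y)
    rwa [ENNReal.toReal_ofReal (hf y)] at this
  have hsm : ∀ y, Monotone fun n => s n y := fun y m n hmn =>
    ENNReal.toReal_mono (ne_top_of_le_ne_top ENNReal.ofReal_ne_top (hle n y))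
      (SimpleFunc.monotone_eapprox _ hmn y)
  have hst : ∀ y, Tendsto (fun n => s n y) atTop (𝓝 (f.1 y)) := fun y => by
    have := (ENNReal.tendsto_toReal ENNReal.ofReal_ne_top).comp
      (SimpleFunc.tendsto_eapprox hm.ennreal_ofReal y)
    rwa [ENNReal.toReal_ofReal (hf y)] at this
  have hsd : ∀ n, (s n : X → ℝ) ∈ R.domain := fun n =>
    R.solid _ _ (s n).measurable f.2 fun y => by
      rw [abs_of_nonneg (hs0 n y), abs_of_nonneg (hf y)]; exact hsf n y
  have hlim : Tendsto (fun n => R.op ⟨s n, hsd n⟩ x) atTop (𝓝 (R.op f x)) := by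
    have h0 := R.tendsto_op (f := fun n => f - ⟨s n, hsd n⟩)
      (fun m n hmn y => sub_le_sub_left (hsm y hmn) _)
      (fun y => by simpa using (hst y).const_sub (f.1 y)) x
    simp only [map_sub, Pi.sub_apply] at h0
    simpa using h0.const_sub (R.op f x)
  have hmono : ∀ n, R.op ⟨s n, hsd n⟩ x ≤ R.op f x := fun n => by
    have := R.op_nonneg (f - ⟨s n, hsd n⟩) (fun y => sub_nonneg.2 (hsf n y)) x
    rw [map_sub, Pi.sub_apply] at this
    linarith
  have hint : Integrable f.1 (R.kernel x) := by
    refine ⟨hm.aestronglyMeasurable, ?_⟩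
    rw [hasFiniteIntegral_iff_ofReal (.of_forall hf)]
    refine lt_of_le_of_lt ?_ (ENNReal.ofReal_lt_top (r := R.op f x))
    refine le_of_tendsto' (lintegral_tendsto_of_tendsto_of_monotone
      (f := fun n y => ENNReal.ofReal (s n y))
      (fun n => (s n).measurable.ennreal_ofReal.aemeasurable)
      (.of_forall fun y m n hmn => ENNReal.ofReal_le_ofReal (hsm y hmn))
      (.of_forall fun y => ENNReal.tendsto_ofReal (hst y))) fun n => ?_
    rw [← ofReal_integral_eq_lintegral_ofReal (SimpleFunc.integrable_of_isFiniteMeasure (s n))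
      (.of_forall (hs0 n)), ← R.op_simple (s n) (hsd n)]
    exact ENNReal.ofReal_le_ofReal (hmono n)
  refine ⟨hint, tendsto_nhds_unique hlim ?_⟩
  simp only [R.op_simple]
  refine tendsto_integral_of_dominated_convergence f.1
    (fun n => (s n).measurable.aestronglyMeasurable) hint
    (fun n => .of_forall fun y => ?_) (.of_forall hst)
  rw [Real.norm_of_nonneg (hs0 n y)]
  exact hsf n y

/-- On its domain, the operator `R` is given by integration against `A ↦ R(χ_A)(x)`. -/
lemma op_eq_integral (f : R.domain) (x : X) :
    Integrable f.1 (R.kernel x) ∧ R.op f x = ∫ y, f.1 y ∂(R.kernel x) := by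
  have hm := R.measurable_of_mem _ f.2
  have hp : (fun y => max (f.1 y) 0) ∈ R.domain :=
    R.solid _ _ (hm.max measurable_const) f.2 fun y => by
      rw [abs_of_nonneg (le_max_right _ _)]; exact max_le (le_abs_self _) (abs_nonneg _)
  have hn : (fun y => max (-f.1 y) 0) ∈ R.domain :=
    R.solid _ _ (hm.neg.max measurable_const) f.2 fun y => by
      rw [abs_of_nonneg (le_max_right _ _)]; exact max_le (neg_le_abs _) (abs_nonneg _)
  have he : f = ⟨_, hp⟩ - ⟨_, hn⟩ := by
    ext y
    change f.1 y = max (f.1 y) 0 - max (-f.1 y) 0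
    rcases le_total (f.1 y) 0 with h | h
    · rw [max_eq_right h, max_eq_left (by linarith)]; ring
    · rw [max_eq_left h, max_eq_right (by linarith)]; ring
  obtain ⟨i1, e1⟩ := R.op_eq_integral_of_nonneg ⟨_, hp⟩ (fun y => le_max_right _ _) x
  obtain ⟨i2, e2⟩ := R.op_eq_integral_of_nonneg ⟨_, hn⟩ (fun y => le_max_right _ _) x
  have he' : f.1 = fun y => max (f.1 y) 0 - max (-f.1 y) 0 := congrArg Subtype.val he
  constructor
  · rw [he']; exact i1.sub i2
  · rw [he, map_sub, Pi.sub_apply, e1, e2, ← integral_sub i1 i2]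
    rfl

lemma apply_eq_integral (f : X → ℝ) (x : X) : R.apply f x = ∫ y, f y ∂(R.kernel x) := by
  unfold apply
  split_ifs with h
  · exact (R.op_eq_integral ⟨f, h⟩ x).2
  · rfl

/-- The measure `A ↦ R(χ_A)(x)` is carried by the fiber `σ⁻¹(x)`. -/
lemma ae_kernel [StandardBorelSpace X] (x : X) :
    ∀ᵐ y ∂(R.kernel x), R.σ y = x := by
  have hS : MeasurableSet (R.σ ⁻¹' {x}ᶜ) := R.measurable_σ (measurableSet_singleton x).compl
  have h0 : R.kernel x (R.σ ⁻¹' {x}ᶜ) = 0 := by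
    rw [R.kernel_apply x hS, opInd]
    have he : (R.σ ⁻¹' {x}ᶜ).indicator (fun _ => (1 : ℝ)) =
        fun y => ({x}ᶜ : Set X).indicator (fun _ => (1 : ℝ)) (R.σ y) * 1 := by
      ext y
      by_cases hy : R.σ y = x <;> simp [hy]
    have h1 : R.op ⟨_, R.indicator_mem hS⟩ x = 0 := by
      have := R.pull_out (({x}ᶜ : Set X).indicator fun _ => 1) ⟨_, R.one_mem⟩
        (measurable_const.indicator (measurableSet_singleton x).compl)
        (he ▸ R.indicator_mem hS) x
      rw [Set.indicator_of_notMem (by simp), zero_mul] at this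
      rw [← this]
      exact congrFun (R.op_congr he _ _) x
    rw [h1, ENNReal.ofReal_zero]
  exact h0

variable {R}

lemma Normalized.isMarkovKernel (hR : R.Normalized) : IsMarkovKernel R.kernel := by
  refine ⟨fun x => ⟨?_⟩⟩
  rw [R.kernel_apply x .univ, opInd]
  have : R.op ⟨_, R.indicator_mem .univ⟩ x = 1 :=
    (congrFun (R.op_congr (Set.indicator_univ _) _ R.one_mem) x).trans (hR x)
  rw [this, ENNReal.ofReal_one]

lemma measurable_apply (hR : R.Normalized) {f : X → ℝ} (hf : Measurable f) :
    Measurable (R.apply f) := by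
  have h : R.apply f = fun x => ∫ y, f y ∂(R.kernel x) := funext (R.apply_eq_integral f)
  have := hR.isMarkovKernel
  rw [h]
  exact (hf.stronglyMeasurable.integral_kernel).measurable

lemma ae_act_iff {μ : Measure X} {P : X → Prop} (hP : MeasurableSet {x | P x}) :
    (∀ᵐ y ∂(R.act μ), P y) ↔ ∀ᵐ x ∂μ, ∀ᵐ y ∂(R.kernel x), P y := by
  change R.act μ {x | P x}ᶜ = 0 ↔ _
  rw [act, Measure.bind_apply hP.compl R.kernel.aemeasurable,
    lintegral_eq_zero_iff (Kernel.measurable_coe _ hP.compl)]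
  rfl

lemma lintegral_act (μ : Measure X) {f : X → ℝ≥0∞} (hf : Measurable f) :
    ∫⁻ y, f y ∂(R.act μ) = ∫⁻ x, ∫⁻ y, f y ∂(R.kernel x) ∂μ :=
  Measure.lintegral_bind R.kernel.aemeasurable hf.aemeasurable

/-- `(μR) ∘ σ⁻¹ = μ` for a normalized operator. -/
lemma map_act (hR : R.Normalized) [StandardBorelSpace X] (μ : Measure X) :
    (R.act μ).map R.σ = μ := by
  have := hR.isMarkovKernel
  ext A hA
  rw [Measure.map_apply R.measurable_σ hA, act,
    Measure.bind_apply (R.measurable_σ hA) R.kernel.aemeasurable]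
  have : ∀ x, R.kernel x (R.σ ⁻¹' A) = A.indicator 1 x := fun x => by
    by_cases hx : x ∈ A
    · rw [Set.indicator_of_mem hx, Pi.one_apply, prob_compl_eq_zero_iff (R.measurable_σ hA) |>.1]
      refine measure_mono_null (fun y hy => ?_) (R.ae_kernel x)
      intro (h : R.σ y = x)
      exact hy (by simpa [h] using hx)
    · rw [Set.indicator_of_notMem hx]
      refine measure_mono_null (fun y hy => ?_) (R.ae_kernel x)
      intro (h : R.σ y = x)
      exact hx (by simpa [h] using hy)
  simp only [this]
  rw [lintegral_indicator_one hA]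

lemma sigmaFinite_act (hR : R.Normalized) [StandardBorelSpace X] (μ : Measure X) [SigmaFinite μ] :
    SigmaFinite (R.act μ) :=
  SigmaFinite.of_map _ R.measurable_σ.aemeasurable (by rw [map_act hR]; infer_instance)

lemma isProbabilityMeasure_act (hR : R.Normalized) (μ : Measure X) [IsProbabilityMeasure μ] :
    IsProbabilityMeasure (R.act μ) := by
  have := hR.isMarkovKernel
  unfold act
  infer_instance

lemma measurePreserving (hR : R.Normalized) [StandardBorelSpace X] (μ : Measure X) :
    MeasurePreserving R.σ (R.act μ) μ := ⟨R.measurable_σ, map_act hR μ⟩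

lemma act_mono {μ ν : Measure X} (h : μ ≪ ν) : R.act μ ≪ R.act ν := by
  refine Measure.AbsolutelyContinuous.mk fun A hA h0 => ?_
  rw [act, Measure.bind_apply hA R.kernel.aemeasurable,
    lintegral_eq_zero_iff (Kernel.measurable_coe _ hA)] at h0 ⊢
  exact h.ae_le h0

lemma act_withDensity [StandardBorelSpace X] (ρ : Measure X) {φ : X → ℝ≥0∞}
    (hφ : Measurable φ) :
    R.act (ρ.withDensity φ) = (R.act ρ).withDensity (fun y => φ (R.σ y)) := by
  ext A hA
  rw [withDensity_apply _ hA, ← lintegral_indicator hA,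
    lintegral_act _ (Measurable.indicator (f := fun y => φ (R.σ y)) (hφ.comp R.measurable_σ) hA), act,
    Measure.bind_apply hA R.kernel.aemeasurable,
    lintegral_withDensity_eq_lintegral_mul _ hφ (Kernel.measurable_coe _ hA)]
  refine lintegral_congr fun x => ?_
  rw [Pi.mul_apply, lintegral_indicator hA]
  have : ∀ᵐ y ∂((R.kernel x).restrict A), φ (R.σ y) = φ x := by
    refine ae_restrict_of_ae ?_
    filter_upwards [R.ae_kernel x] with y hy
    rw [hy]
  rw [lintegral_congr_ae this, lintegral_const, Measure.restrict_apply_univ]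

lemma rnDeriv_act (hR : R.Normalized) [StandardBorelSpace X] {μ ρ : Measure X} [SigmaFinite μ]
    [SigmaFinite ρ] (h : μ ≪ ρ) :
    (R.act μ).rnDeriv (R.act ρ) =ᵐ[R.act ρ] fun y => μ.rnDeriv ρ (R.σ y) := by
  have := sigmaFinite_act hR ρ
  conv_lhs => rw [← Measure.withDensity_rnDeriv_eq μ ρ h,
    act_withDensity ρ (Measure.measurable_rnDeriv _ _)]
  exact Measure.rnDeriv_withDensity _ ((Measure.measurable_rnDeriv _ _).comp R.measurable_σ)

/-- The function `R(f)` is in `L²(ν)` if `f` is in `L²(νR)`. -/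
lemma memLp_apply (hR : R.Normalized) (ν : Measure X) {f : X → ℝ} (hf : Measurable f) (h2 : MemLp f 2 (R.act ν)) :
    MemLp (R.apply f) 2 ν := by
  have := hR.isMarkovKernel
  refine ⟨(measurable_apply hR hf).aestronglyMeasurable, ?_⟩
  have h3 := h2.2
  rw [eLpNorm_lt_top_iff_lintegral_rpow_enorm_lt_top two_ne_zero ENNReal.ofNat_ne_top] at h3 ⊢
  rw [lintegral_act _ (by fun_prop)] at h3
  refine lt_of_le_of_lt (lintegral_mono fun x => ?_) h3
  rw [R.apply_eq_integral]
  have h4 : ‖∫ y, f y ∂(R.kernel x)‖ₑ ≤ eLpNorm f 2 (R.kernel x) :=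
    (enorm_integral_le_lintegral_enorm f).trans (by
      rw [← eLpNorm_one_eq_lintegral_enorm]
      exact eLpNorm_le_eLpNorm_of_exponent_le one_le_two hf.aestronglyMeasurable)
  refine (ENNReal.rpow_le_rpow h4 (by norm_num)).trans_eq ?_
  rw [eLpNorm_eq_lintegral_rpow_enorm_toReal two_ne_zero ENNReal.ofNat_ne_top, ← ENNReal.rpow_mul]
  norm_num

section Operators

variable [StandardBorelSpace X] (hR : R.Normalized)

/-- The map `(f, μ) ↦ (f ∘ σ, μR)` on pairs. -/
noncomputable def shatPair (p : SqrtPair X) : SqrtPair X where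
  measure := R.act p.measure
  fn := fun x => p.fn (R.σ x)
  sigmaFinite := sigmaFinite_act hR _
  measurable_fn := p.measurable_fn.comp R.measurable_σ
  memLp := p.memLp.comp_measurePreserving (measurePreserving hR _)

lemma density_shatPair (p : SqrtPair X) {ρ : Measure X} [SigmaFinite ρ] (h : p.measure ≪ ρ) :
    (shatPair hR p).density (R.act ρ) =ᵐ[R.act ρ] fun y => p.density ρ (R.σ y) := by
  filter_upwards [rnDeriv_act hR h] with y hy
  simp only [SqrtPair.density, shatPair]
  rw [hy]

lemma shatPair_equivalent {p q : SqrtPair X} (h : p.Equivalent q) :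
    (shatPair hR p).Equivalent (shatPair hR q) := by
  obtain ⟨ρ, hρ, hp, hq, he⟩ := h
  refine ⟨R.act ρ, sigmaFinite_act hR ρ, act_mono hp, act_mono hq, ?_⟩
  filter_upwards [density_shatPair hR p hp, density_shatPair hR q hq,
    (measurePreserving hR ρ).quasiMeasurePreserving.ae he] with y h1 h2 h3
  rw [h1, h2, h3]

/-- The operator `Ŝ(f √dμ) = (f ∘ σ) √d(μR)` on `ℋ(X)`. -/
noncomputable def shat : UniversalHilbert X → UniversalHilbert X :=
  Quotient.map (shatPair hR) fun _ _ h => shatPair_equivalent hR h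

/-- The closed subspace `ℋ_{K₁}` of `ℋ(X)` spanned by the subspaces `ℋ(μ)`, `μ ∈ K₁`. -/
noncomputable def spanK₁ (R : TransferOperator X) : Submodule ℝ (UniversalHilbert X) :=
  (Submodule.span ℝ {v | ∃ (μ : Measure X) (_ : SigmaFinite μ), μ ∈ R.K₁ ∧
    v ∈ UniversalHilbert.subspace μ}).topologicalClosure

/-- The vectors of `ℋ(νR)`, with `ν` running over the probability measures. -/
def vecK₁ (R : TransferOperator X) : Set (UniversalHilbert X) :=
  {v | ∃ (ν : Measure X) (_ : IsProbabilityMeasure ν) (_ : SigmaFinite (R.act ν)),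
    v ∈ UniversalHilbert.subspace (R.act ν)}

lemma vecK₁_mem_common (hR : R.Normalized) {v : ℕ → UniversalHilbert X} (hv : ∀ n, v n ∈ R.vecK₁) :
    ∃ (ν : Measure X) (_ : IsProbabilityMeasure ν) (_ : SigmaFinite (R.act ν)),
      ∀ n, v n ∈ UniversalHilbert.subspace (R.act ν) := by
  choose ν hν hs hv using hv
  have : NeZero (Measure.sum ν) := ⟨fun h => by
    have h1 := Measure.le_sum ν 0
    rw [h] at h1
    have h2 := h1 Set.univ
    simp at h2⟩
  have hS := sigmaFinite_act hR (Measure.sum ν).toFinite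
  exact ⟨(Measure.sum ν).toFinite, inferInstance, hS, fun n =>
    UniversalHilbert.subspace_mono (act_mono ((Measure.le_sum ν n).absolutelyContinuous.trans
      (absolutelyContinuous_toFinite _))) (hv n)⟩

lemma mem_spanK₁_iff (hR : R.Normalized) [Nonempty X] {v : UniversalHilbert X} : v ∈ R.spanK₁ ↔ v ∈ R.vecK₁ := by
  constructor
  · let V : Submodule ℝ (UniversalHilbert X) :=
      { carrier := R.vecK₁
        add_mem' := fun {a b} ha hb => by
          obtain ⟨ν, hν, hs, h⟩ := vecK₁_mem_common hR (v := fun n => if n = 0 then a else b)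
            (fun n => by split_ifs <;> assumption)
          exact ⟨ν, hν, hs, add_mem (by simpa using h 0) (by simpa using h 1)⟩
        zero_mem' := by
          obtain ⟨x⟩ := ‹Nonempty X›
          exact ⟨Measure.dirac x, inferInstance, sigmaFinite_act hR _, zero_mem _⟩
        smul_mem' := fun c a ⟨ν, hν, hs, h⟩ => ⟨ν, hν, hs, Submodule.smul_mem _ c h⟩ }
    have hV : IsClosed (V : Set (UniversalHilbert X)) := by
      refine IsSeqClosed.isClosed fun u a hu ha => ?_
      obtain ⟨ν, hν, hs, h⟩ := vecK₁_mem_common hR hu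
      exact ⟨ν, hν, hs,
        (UniversalHilbert.isComplete_subspace _).isClosed.mem_of_tendsto ha (.of_forall h)⟩
    intro hv
    refine Submodule.topologicalClosure_minimal _ (Submodule.span_le.2 ?_) hV hv
    rintro w ⟨μ, hμ, ⟨ν, hν, rfl⟩, hw⟩
    exact ⟨ν, hν, hμ, hw⟩
  · rintro ⟨ν, hν, hs, hv⟩
    exact Submodule.le_topologicalClosure _
      (Submodule.subset_span ⟨R.act ν, hs, ⟨ν, hν, rfl⟩, hv⟩)

/-- The vector `R(f) √d(μ ∘ σ⁻¹)`, for `μ ∈ K₁` and `f ∈ L²(μ)`. -/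
noncomputable def rhatVec {μ : Measure X} (hμ : μ ∈ R.K₁) (f : X → ℝ) (hf : Measurable f)
    (h2 : MemLp f 2 μ) : UniversalHilbert X :=
  UniversalHilbert.mk
    { measure := μ.map R.σ
      fn := R.apply f
      sigmaFinite := by
        obtain ⟨ν, hν, rfl⟩ := hμ
        rw [map_act hR]; infer_instance
      measurable_fn := measurable_apply hR hf
      memLp := by
        obtain ⟨ν, hν, rfl⟩ := hμ
        rw [map_act hR]; exact memLp_apply hR ν hf h2 }

lemma rhatVec_congr {μ μ' : Measure X} (hμ : μ ∈ R.K₁) (hμ' : μ' ∈ R.K₁) [SigmaFinite μ]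
    [SigmaFinite μ'] {f f' : X → ℝ} {hf : Measurable f} {h2 : MemLp f 2 μ}
    {hf' : Measurable f'} {h2' : MemLp f' 2 μ'}
    (h : UniversalHilbert.vec μ f hf h2 = UniversalHilbert.vec μ' f' hf' h2') :
    rhatVec hR hμ f hf h2 = rhatVec hR hμ' f' hf' h2' := by
  obtain ⟨ν, hν, rfl⟩ := id hμ
  obtain ⟨ν', hν', rfl⟩ := id hμ'
  have hτ : ν ≪ ν + ν' := Measure.AbsolutelyContinuous.rfl.add_right _
  have hτ' : ν' ≪ ν + ν' := Measure.AbsolutelyContinuous.rfl.add_right' _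
  have := sigmaFinite_act hR (ν + ν')
  have key := UniversalHilbert.mk_eq_iff_density.1 h (R.act (ν + ν')) this
  have h3 : ∀ᵐ y ∂(R.act (ν + ν')),
      f y * Real.sqrt (ν.rnDeriv (ν + ν') (R.σ y)).toReal =
        f' y * Real.sqrt (ν'.rnDeriv (ν + ν') (R.σ y)).toReal := by
    filter_upwards [key, rnDeriv_act hR hτ, rnDeriv_act hR hτ'] with y h1 h2 h3
    simp only [SqrtPair.density] at h1
    rwa [h2, h3] at h1
  have hm : ∀ κ : Measure X, Measurable fun y =>
      Real.sqrt (κ.rnDeriv (ν + ν') (R.σ y)).toReal := fun κ =>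
    Real.continuous_sqrt.measurable.comp
      (((Measure.measurable_rnDeriv _ _).comp R.measurable_σ).ennreal_toReal)
  replace h3 := (ae_act_iff (measurableSet_eq_fun (hf.mul (hm ν)) (hf'.mul (hm ν')))).1 h3
  refine UniversalHilbert.mk_eq_iff.2 ⟨ν + ν', inferInstance, ?_, ?_, ?_⟩
  · simpa only [map_act hR] using hτ
  · simpa only [map_act hR] using hτ'
  · filter_upwards [h3] with x hx
    simp only [SqrtPair.density, map_act hR, apply_eq_integral]
    rw [← integral_mul_const, ← integral_mul_const]
    refine integral_congr_ae ?_
    filter_upwards [hx, R.ae_kernel x] with y h4 h5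
    simp only [Pi.mul_apply, h5] at h4
    exact h4

/-- The defining relation of `R̂`: if `v = f √dμ + u` with `μ ∈ K₁` and `u ⟂ ℋ_{K₁}`, then
`R̂ v = R(f) √d(μ ∘ σ⁻¹)`. -/
def IsRhat (v w : UniversalHilbert X) : Prop :=
  ∃ (μ : Measure X) (_ : SigmaFinite μ) (hμ : μ ∈ R.K₁) (f : X → ℝ) (hf : Measurable f)
    (h2 : MemLp f 2 μ) (u : UniversalHilbert X), u ∈ R.spanK₁ᗮ ∧
    v = UniversalHilbert.vec μ f hf h2 + u ∧ w = rhatVec hR hμ f hf h2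

theorem existsUnique_isRhat [Nonempty X] (v : UniversalHilbert X) : ∃! w, IsRhat hR v w := by
  have hcl : IsClosed (R.spanK₁ : Set (UniversalHilbert X)) :=
    Submodule.isClosed_topologicalClosure _
  have : CompleteSpace R.spanK₁ := hcl.completeSpace_coe
  obtain ⟨y, hy, u, hu, rfl⟩ := R.spanK₁.exists_add_mem_mem_orthogonal v
  obtain ⟨ν, hν, hs, hy'⟩ := (mem_spanK₁_iff hR).1 hy
  obtain ⟨f, hf, h2, rfl⟩ := UniversalHilbert.mem_subspace_iff.1 hy'
  refine ⟨rhatVec hR ⟨ν, hν, rfl⟩ f hf h2, ⟨_, hs, ⟨ν, hν, rfl⟩, f, hf, h2, u, hu, rfl, rfl⟩, ?_⟩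
  rintro w ⟨μ, hμs, hμ, g, hg, hg2, u', hu', h, rfl⟩
  refine rhatVec_congr hR hμ _ ?_
  have hgm : UniversalHilbert.vec μ g hg hg2 ∈ R.spanK₁ :=
    Submodule.le_topologicalClosure _
      (Submodule.subset_span ⟨μ, hμs, hμ, UniversalHilbert.vec_mem_subspace μ hg hg2⟩)
  have h3 : UniversalHilbert.vec μ g hg hg2 - UniversalHilbert.vec (R.act ν) f hf h2 = u - u' := by
    rw [sub_eq_sub_iff_add_eq_add, ← h, add_comm]
  have h4 := Submodule.sub_mem _ hgm hy
  have h5 : UniversalHilbert.vec μ g hg hg2 - UniversalHilbert.vec (R.act ν) f hf h2 ∈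
      R.spanK₁ᗮ := h3 ▸ Submodule.sub_mem _ hu hu'
  exact sub_eq_zero.1 (inner_self_eq_zero.1 (Submodule.inner_right_of_mem_orthogonal h4 h5))

/-- The operator `R̂` on `ℋ(X)`: it sends `f √dμ` with `μ ∈ K₁` to `R(f) √d(μ ∘ σ⁻¹)`, and it
vanishes on the orthogonal complement of `ℋ_{K₁}`. -/
noncomputable def rhat [Nonempty X] (v : UniversalHilbert X) : UniversalHilbert X :=
  (existsUnique_isRhat hR v).choose

lemma rhat_vec [Nonempty X] {μ : Measure X} [SigmaFinite μ] (hμ : μ ∈ R.K₁) {f : X → ℝ}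
    (hf : Measurable f) (h2 : MemLp f 2 μ) :
    rhat hR (UniversalHilbert.vec μ f hf h2) = rhatVec hR hμ f hf h2 :=
  ((existsUnique_isRhat hR _).choose_spec.2 _
    ⟨μ, inferInstance, hμ, f, hf, h2, 0, zero_mem _, (add_zero _).symm, rfl⟩).symm

lemma rhat_orthogonal [Nonempty X] {u : UniversalHilbert X} (hu : u ∈ R.spanK₁ᗮ) :
    rhat hR u = 0 := by
  obtain ⟨x⟩ := id ‹Nonempty X›
  have := sigmaFinite_act hR (Measure.dirac x)
  have h0 : ∀ (μ : Measure X) [SigmaFinite μ],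
      UniversalHilbert.vec μ (fun _ => 0) measurable_const MemLp.zero' = 0 := fun μ _ =>
    UniversalHilbert.mk_eq_iff_density.2 fun τ _ => .of_forall fun y => by
      simp [SqrtPair.density, SqrtPair.zero]
  refine ((existsUnique_isRhat hR _).choose_spec.2 _
    ⟨_, this, ⟨Measure.dirac x, inferInstance, rfl⟩, fun _ => 0, measurable_const, MemLp.zero', u,
      hu, by rw [h0, zero_add], ?_⟩).symm
  refine UniversalHilbert.mk_eq_iff_density.2 fun τ _ => .of_forall fun y => ?_
  simp [SqrtPair.density, SqrtPair.zero, apply_eq_integral]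

end Operators

/-- The conditional expectation `𝔼_μ(f | σ⁻¹(𝓑))`. -/
noncomputable def condExpσ (R : TransferOperator X) (μ : Measure X) (f : X → ℝ) : X → ℝ :=
  μ[f | MeasurableSpace.comap R.σ inferInstance]

lemma measurable_condExpσ (R : TransferOperator X) (μ : Measure X) (f : X → ℝ) :
    Measurable (R.condExpσ μ f) :=
  (stronglyMeasurable_condExp.mono R.measurable_σ.comap_le).measurable

lemma memLp_condExpσ (R : TransferOperator X) {μ : Measure X} {f : X → ℝ} (h : MemLp f 2 μ) :
    MemLp (R.condExpσ μ f) 2 μ := h.condExp one_le_two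

end TransferOperator

/-!
A normalized transfer operator integrates against a Markov kernel `κ` carried by the fibers of `σ`.
Hence `(μ ∘ σ⁻¹) R = μ` says that `κ` is the conditional distribution of the identity given `σ`
under `μ`, which turns `f ↦ R(f) ∘ σ` into the conditional expectation on `σ⁻¹(𝓑)`; conversely,
integrating `R(χ_A) ∘ σ = 𝔼_μ(χ_A | σ⁻¹(𝓑))` gives back `(μ ∘ σ⁻¹) R = μ`.

To recover invariance from the operators on `ℋ(X)`, attach to a vector `f √dμ` the measure `f² dμ`.
It does not depend on the representative, and `Ŝ` acts on it by `m ↦ mR`. Since the conditional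
expectation fixes `1`, statement (4) puts `√dμ` in the range of `Ŝ`, so `μ = mR` for some
measure `m`, and then `m = (mR) ∘ σ⁻¹ = μ ∘ σ⁻¹`.
-/

section FiberKernel

variable {X Y : Type*} [MeasurableSpace X] [MeasurableSpace Y] {κ : Kernel Y X} {σ : X → Y}

lemma map_prodMk_comp_eq_compProd {ν : Measure Y} [SFinite ν] [IsSFiniteKernel κ]
    (hσ : Measurable σ) (hfiber : ∀ᵐ y ∂ν, ∀ᵐ x ∂κ y, σ x = y) :
    (κ ∘ₘ ν).map (fun x => (σ x, x)) = ν ⊗ₘ κ := by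
  have hgraph : Measurable fun x => (σ x, x) := hσ.prodMk measurable_id
  ext s hs
  rw [Measure.map_apply hgraph hs, Measure.bind_apply (hgraph hs) κ.aemeasurable,
    Measure.compProd_apply hs]
  refine lintegral_congr_ae ?_
  filter_upwards [hfiber] with y hy
  refine measure_congr ?_
  filter_upwards [hy] with x hx
  change ((σ x, x) ∈ s) = ((y, x) ∈ s)
  rw [hx]

variable {μ : Measure X} [IsFiniteMeasure μ]

lemma condDistrib_id_ae_eq_of_comp_map_eq [StandardBorelSpace X] [Nonempty X] [IsFiniteKernel κ]
    (hσ : Measurable σ) (hfiber : ∀ᵐ y ∂μ.map σ, ∀ᵐ x ∂κ y, σ x = y)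
    (hμ : κ ∘ₘ μ.map σ = μ) : condDistrib id σ μ =ᵐ[μ.map σ] κ := by
  refine condDistrib_ae_eq_of_measure_eq_compProd σ aemeasurable_id ?_
  simpa only [hμ, id_eq] using map_prodMk_comp_eq_compProd hσ hfiber

lemma condExp_comap_ae_eq_integral_of_comp_map_eq [StandardBorelSpace X] [Nonempty X]
    [IsFiniteKernel κ] {E : Type*} [NormedAddCommGroup E] [NormedSpace ℝ E] [CompleteSpace E]
    {f : X → E} (hσ : Measurable σ) (hfiber : ∀ᵐ y ∂μ.map σ, ∀ᵐ x ∂κ y, σ x = y)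
    (hμ : κ ∘ₘ μ.map σ = μ) (hf : Integrable f μ) :
    μ[f | MeasurableSpace.comap σ inferInstance] =ᵐ[μ] fun x => ∫ z, f z ∂κ (σ x) := by
  filter_upwards [condExp_ae_eq_integral_condDistrib_id hσ hf,
    ae_of_ae_map hσ.aemeasurable (condDistrib_id_ae_eq_of_comp_map_eq hσ hfiber hμ)] with x hx hκ
  rw [hx, hκ]

lemma comp_map_eq_of_condExp_indicator_ae_eq [∀ y, IsFiniteMeasure (κ y)] (hσ : Measurable σ)
    (h : ∀ A : Set X, MeasurableSet A →
      μ[A.indicator fun _ => (1 : ℝ) | MeasurableSpace.comap σ inferInstance] =ᵐ[μ]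
        fun x => (κ (σ x)).real A) :
    κ ∘ₘ μ.map σ = μ := by
  ext A hA
  have hreal : ∫ x, (κ (σ x)).real A ∂μ = μ.real A := by
    rw [← integral_congr_ae (h A hA), integral_condExp hσ.comap_le, integral_indicator_const _ hA,
      smul_eq_mul, mul_one]
  have hint : Integrable (fun x => (κ (σ x)).real A) μ := integrable_condExp.congr (h A hA)
  calc (κ ∘ₘ μ.map σ) A = ∫⁻ x, κ (σ x) A ∂μ := by
        rw [Measure.bind_apply hA κ.aemeasurable, lintegral_map (κ.measurable_coe hA) hσ]
    _ = ENNReal.ofReal (∫ x, (κ (σ x)).real A ∂μ) := by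
        rw [ofReal_integral_eq_lintegral_ofReal hint (.of_forall fun _ => measureReal_nonneg)]
        exact lintegral_congr fun x => by rw [ofReal_measureReal]
    _ = μ A := by rw [hreal, ofReal_measureReal]

end FiberKernel

namespace SqrtPair

variable {X : Type*} [MeasurableSpace X]

/-- The measure `f² dμ` of the pair `(f, μ)`. -/
noncomputable def sqMeasure (p : SqrtPair X) : Measure X :=
  p.measure.withDensity fun x => ENNReal.ofReal (p.fn x ^ 2)

lemma sqMeasure_eq_withDensity_density (p : SqrtPair X) {ρ : Measure X} [SigmaFinite ρ]
    (h : p.measure ≪ ρ) :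
    p.sqMeasure = ρ.withDensity fun x => ENNReal.ofReal (p.density ρ x ^ 2) := by
  rw [sqMeasure]
  conv_lhs => rw [← Measure.withDensity_rnDeriv_eq p.measure ρ h]
  rw [← withDensity_mul ρ (Measure.measurable_rnDeriv _ _)
    (p.measurable_fn.pow_const 2).ennreal_ofReal]
  refine withDensity_congr_ae ?_
  filter_upwards [Measure.rnDeriv_lt_top p.measure ρ] with x hx
  rw [density, mul_pow, Real.sq_sqrt ENNReal.toReal_nonneg, ENNReal.ofReal_mul (sq_nonneg _),
    ENNReal.ofReal_toReal hx.ne, Pi.mul_apply, mul_comm]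

lemma sqMeasure_eq_of_equivalent {p q : SqrtPair X} (h : p.Equivalent q) :
    p.sqMeasure = q.sqMeasure := by
  obtain ⟨ρ, _, hp, hq, hpq⟩ := h
  rw [p.sqMeasure_eq_withDensity_density hp, q.sqMeasure_eq_withDensity_density hq]
  refine withDensity_congr_ae ?_
  filter_upwards [hpq] with x hx
  rw [hx]

end SqrtPair

namespace UniversalHilbert

variable {X : Type*} [MeasurableSpace X]

/-- The measure `f² dμ` attached to the vector `f √dμ`: the square modulus of the vector, with
values in measures. It recovers `μ` from `√dμ`. -/
noncomputable def sqMeasure : UniversalHilbert X → Measure X :=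
  Quotient.lift SqrtPair.sqMeasure fun _ _ => SqrtPair.sqMeasure_eq_of_equivalent

lemma sqMeasure_vec_one (μ : Measure X) [IsFiniteMeasure μ] :
    sqMeasure (vec μ (fun _ => 1) measurable_const (memLp_const 1)) = μ := by
  change μ.withDensity (fun _ => ENNReal.ofReal (1 ^ 2)) = μ
  rw [one_pow, ENNReal.ofReal_one]
  exact withDensity_one

end UniversalHilbert

namespace TransferOperator

variable {X : Type*} [MeasurableSpace X] {R : TransferOperator X}

lemma apply_indicator_one {A : Set X} (hA : MeasurableSet A) (x : X) :
    R.apply (A.indicator fun _ => 1) x = (R.kernel x).real A := by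
  rw [apply_eq_integral, integral_indicator_const _ hA, smul_eq_mul, mul_one]

lemma act_map_eq_of_apply_indicator_ae_eq {μ : Measure X} [IsFiniteMeasure μ]
    (h : ∀ A : Set X, MeasurableSet A →
      (fun x => R.apply (A.indicator fun _ => 1) (R.σ x)) =ᵐ[μ]
        R.condExpσ μ (A.indicator fun _ => 1)) :
    R.act (μ.map R.σ) = μ := by
  refine comp_map_eq_of_condExp_indicator_ae_eq R.measurable_σ fun A hA => ?_
  simpa only [apply_indicator_one hA, condExpσ] using (h A hA).symm

lemma ae_integrable_kernel_of_act_map_eq {μ : Measure X} (hμ : R.act (μ.map R.σ) = μ) {f : X → ℝ}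
    (hf : Integrable f μ) : ∀ᵐ x ∂μ, Integrable f (R.kernel (R.σ x)) :=
  ae_of_ae_map R.measurable_σ.aemeasurable
    (Measure.ae_integrable_of_integrable_comp (hμ.symm ▸ hf : Integrable f (R.act (μ.map R.σ))))

variable [StandardBorelSpace X]

lemma mem_K₁_iff_act_map_eq (hR : R.Normalized) {μ : Measure X} [IsProbabilityMeasure μ] :
    μ ∈ R.K₁ ↔ R.act (μ.map R.σ) = μ := by
  constructor
  · rintro ⟨ν, -, rfl⟩
    rw [map_act hR]
  · exact fun h => ⟨μ.map R.σ, Measure.isProbabilityMeasure_map R.measurable_σ.aemeasurable, h.symm⟩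

lemma apply_comp_ae_eq_condExpσ [Nonempty X] (hR : R.Normalized) {μ : Measure X}
    [IsFiniteMeasure μ] (hμ : R.act (μ.map R.σ) = μ) {f : X → ℝ} (hf : Integrable f μ) :
    (fun x => R.apply f (R.σ x)) =ᵐ[μ] R.condExpσ μ f := by
  have := hR.isMarkovKernel
  simp only [apply_eq_integral]
  exact (condExp_comap_ae_eq_integral_of_comp_map_eq R.measurable_σ
    (.of_forall R.ae_kernel) hμ hf).symm

lemma shat_rhat_vec_eq_condExpσ [Nonempty X] (hR : R.Normalized) {μ : Measure X}
    [IsProbabilityMeasure μ] (hμ : R.act (μ.map R.σ) = μ) {f : X → ℝ} (hf : Measurable f)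
    (h2 : MemLp f 2 μ) :
    shat hR (rhat hR (UniversalHilbert.vec μ f hf h2)) =
      UniversalHilbert.vec μ (R.condExpσ μ f) (R.measurable_condExpσ μ f)
        (R.memLp_condExpσ h2) := by
  rw [rhat_vec hR ((mem_K₁_iff_act_map_eq hR).2 hμ)]
  exact UniversalHilbert.mk_eq_iff.2 (SqrtPair.equivalent_of_ae hμ rfl
    (apply_comp_ae_eq_condExpσ hR hμ (h2.integrable one_le_two)))

lemma sqMeasure_shat (hR : R.Normalized) (v : UniversalHilbert X) :
    (shat hR v).sqMeasure = R.act v.sqMeasure := by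
  obtain ⟨p, rfl⟩ := UniversalHilbert.exists_mk v
  exact (R.act_withDensity p.measure (p.measurable_fn.pow_const 2).ennreal_ofReal).symm

lemma act_map_sqMeasure_shat (hR : R.Normalized) (v : UniversalHilbert X) :
    R.act ((shat hR v).sqMeasure.map R.σ) = (shat hR v).sqMeasure := by
  rw [sqMeasure_shat, map_act hR]

lemma act_map_eq_of_shat_eq_vec_one (hR : R.Normalized) {μ : Measure X} [IsFiniteMeasure μ]
    {v : UniversalHilbert X}
    (hv : shat hR v = UniversalHilbert.vec μ (fun _ => 1) measurable_const (memLp_const 1)) :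
    R.act (μ.map R.σ) = μ := by
  simpa only [hv, UniversalHilbert.sqMeasure_vec_one] using act_map_sqMeasure_shat hR v

end TransferOperator

theorem mainTheorem9 {X : Type*} [MeasurableSpace X] [StandardBorelSpace X] [Nonempty X]
    (R : TransferOperator X) (hR : R.Normalized) (μ : Measure X) [IsProbabilityMeasure μ] :
    List.TFAE [
      -- (1) `μ` belongs to `K₁ = M₁(X) R`
      μ ∈ R.K₁,
      -- (2) `(μ ∘ σ⁻¹) R = μ`
      R.act (μ.map R.σ) = μ,
      -- (3) `f ↦ R(f) ∘ σ` is defined on `L²(μ)` and is the conditional expectation on `σ⁻¹(𝓑)`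
      ∀ f : X → ℝ, Measurable f → MemLp f 2 μ →
        (∀ᵐ x ∂μ, Integrable f (R.kernel (R.σ x))) ∧
          (fun x => R.apply f (R.σ x)) =ᵐ[μ] R.condExpσ μ f,
      -- (4) `Ŝ R̂` leaves `ℋ(μ)` invariant and acts on it as the conditional expectation
      (∀ v ∈ UniversalHilbert.subspace μ,
        TransferOperator.shat hR (TransferOperator.rhat hR v) ∈ UniversalHilbert.subspace μ) ∧
      ∀ (f : X → ℝ) (hf : Measurable f) (h2 : MemLp f 2 μ),
        TransferOperator.shat hR (TransferOperator.rhat hR (UniversalHilbert.vec μ f hf h2)) =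
          UniversalHilbert.vec μ (R.condExpσ μ f) (R.measurable_condExpσ μ f)
            (R.memLp_condExpσ h2)] := by
  tfae_have 1 ↔ 2 := TransferOperator.mem_K₁_iff_act_map_eq hR
  tfae_have 2 → 3 := fun hμ f _ h2 =>
    have hf : Integrable f μ := h2.integrable one_le_two
    ⟨TransferOperator.ae_integrable_kernel_of_act_map_eq hμ hf,
      TransferOperator.apply_comp_ae_eq_condExpσ hR hμ hf⟩
  tfae_have 3 → 2 := fun h => TransferOperator.act_map_eq_of_apply_indicator_ae_eq fun A hA =>
    (h _ (measurable_const.indicator hA) ((memLp_const 1).indicator hA)).2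
  tfae_have 2 → 4 := by
    refine fun hμ => ⟨fun v hv => ?_, fun f => TransferOperator.shat_rhat_vec_eq_condExpσ hR hμ⟩
    obtain ⟨f, hf, h2, rfl⟩ := UniversalHilbert.mem_subspace_iff.1 hv
    rw [TransferOperator.shat_rhat_vec_eq_condExpσ hR hμ]
    exact UniversalHilbert.vec_mem_subspace _ _ _
  tfae_have 4 → 2 := by
    rintro ⟨-, h⟩
    have hone : R.condExpσ μ (fun _ => 1) = fun _ => 1 := condExp_const R.measurable_σ.comap_le 1
    exact TransferOperator.act_map_eq_of_shat_eq_vec_one hR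
      ((h _ measurable_const (memLp_const 1)).trans
        (UniversalHilbert.vec_congr (.of_eq hone)))
  tfae_finish
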